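/- Let $K<T$ and $M$ be nonnegative integers, let $\rho,\sigma>0$, and let $\mathbf H=[\mathbf h_1\,\cdots\,\mathbf h_K]\in\mathbb C^{M\times K}$ be a channel realization with $\mathbf H^H\mathbf H$ invertible (so $M\ge K$). A zero-forcing (ZF) precoding matrix for $\mathbf H$ is a matrix $\mathbf V=[\mathbf v_1\,\cdots\,\mathbf v_K]=\mathbf H(\mathbf H^H\mathbf H)^{-1}\mathbf D$ with $\mathbf D\in\mathbb C^{K\times K}$ diagonal. The information rate of user $k$ is $$\Big(1-\frac KT\Big)\log_2\Big(1+\frac{|\mathbf h_k^H\mathbf v_k|^2}{\sum_{\ell\ne k}|\mathbf h_k^H\mathbf v_\ell|^2+\sigma^2}\Big).$$ (a) If $\mathbf V$ is a ZF precoding matrix that gives every user the rate $R=\big(1-\frac KT\big)\log_2\big(1+\rho(M-K)\big)$, then the total transmit power is $$\sum_{k=1}^K\|\mathbf v_k\|^2=\rho\sigma^2(M-K)\,\mathrm{tr}\big((\mathbf H^H\mathbf H)^{-1}\big).$$ The choice $\mathbf V=\sqrt{\rho\sigma^2(M-K)}\,\mathbf H(\mathbf H^H\mathbf H)^{-1}$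 is such a matrix, with $\mathbf h_k^H\mathbf v_k=\sqrt{\rho\sigma^2(M-K)}$ for all $k$. (b) Let $M>K$. Suppose that the channel variances $\lambda_1,\dots,\lambda_K$ are independent random variables with common probability density $f_\lambda$ on $(0,\infty)$ and that, conditionally on $(\lambda_1,\dots,\lambda_K)$, the vectors $\mathbf h_1,\dots,\mathbf h_K$ are independent with $\mathbf h_k\sim\mathcal{CN}(\mathbf 0,\lambda_k\mathbf I_M)$ (Rayleigh fading). Then $\mathbf H^H\mathbf H$ is almost surely invertible. If, for almost every realization with $\mathbf H^H\mathbf H$ invertible, $\mathbf V$ is a ZF precoding matrix for $\mathbf H$ giving every user the rate $R$, then the average rate $\big(1-\frac KT\big)\mathbb E\big\{\log_2\big(1+\frac{|\mathbf h_k^H\mathbf v_k|^2}{\sum_{\ell\ne k}|\mathbf h_k^H\mathbf v_\ell|^2+\sigma^2}\big)\big\}$ of every user is also $R$, and the average total transmit power is $$\sum_{k=1}^K\mathbb E\{\|\mathbf v_k\|^2\}=\rho K A_\lambda,\qquad A_\lambda=\mathbb E\Big\{\frac{\sigma^2}{\lambda_k}\Big\}=\int_0^\infty\frac{\sigma^2}{x}f_\lambda(x)\,dx\quad\text{for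 every }k,$$ as an identity in $[0,\infty]$; in particular, if $A_\lambda<\infty$, all these expectations are finite. -/

import Mathlib

open MeasureTheory ProbabilityTheory
open scoped Matrix

noncomputable section

namespace ZFPrecoding

/-- `V = [v₁ … v_K]` is a zero-forcing precoding matrix for the channel matrix
`H = [h₁ … h_K]` (with `Hᴴ H` invertible): the pseudo-inverse `H (Hᴴ H)⁻¹`, whose `k`-th column is
scaled by an arbitrary complex gain `d k`. -/
def IsZF {M K : ℕ} (H V : Matrix (Fin M) (Fin K) ℂ) : Prop :=
  ∃ d : Fin K → ℂ, V = H * (Hᴴ * H)⁻¹ * Matrix.diagonal d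

/-- The zero-forcing precoding matrix `√(ρ σ² (M - K)) H (Hᴴ H)⁻¹`. -/
def zf {M K : ℕ} (ρ σ : ℝ) (H : Matrix (Fin M) (Fin K) ℂ) : Matrix (Fin M) (Fin K) ℂ :=
  ((Real.sqrt (ρ * σ ^ 2 * ((M : ℝ) - K)) : ℝ) : ℂ) • (H * (Hᴴ * H)⁻¹)

/-- The signal-to-interference-and-noise ratio of user `k`; note `(Hᴴ * V) k l = h_kᴴ v_l`. -/
def sinr {M K : ℕ} (σ : ℝ) (H V : Matrix (Fin M) (Fin K) ℂ) (k : Fin K) : ℝ :=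
  ‖(Hᴴ * V) k k‖ ^ 2 / ((∑ l ∈ Finset.univ.erase k, ‖(Hᴴ * V) k l‖ ^ 2) + σ ^ 2)

/-- The information rate of user `k` for one channel realization, with pilot overhead `K / T`. -/
def rate {M K : ℕ} (T : ℕ) (σ : ℝ) (H V : Matrix (Fin M) (Fin K) ℂ) (k : Fin K) : ℝ :=
  (1 - (K : ℝ) / T) * Real.logb 2 (1 + sinr σ H V k)

/-- The average information rate of user `k` for random channel and precoding matrices. -/
def avgRate {M K : ℕ} {Ω : Type*} [MeasurableSpace Ω] (μ : Measure Ω) (T : ℕ) (σ : ℝ)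
    (H V : Ω → Matrix (Fin M) (Fin K) ℂ) (k : Fin K) : ℝ :=
  (1 - (K : ℝ) / T) * ∫ ω, Real.logb 2 (1 + sinr σ (H ω) (V ω) k) ∂μ

/-- The transmit power `‖v_k‖²` (Euclidean norm) spent on user `k`. -/
def power {M K : ℕ} (V : Matrix (Fin M) (Fin K) ℂ) (k : Fin K) : ℝ :=
  ‖WithLp.toLp 2 (fun m => V m k)‖ ^ 2

/-- The circularly symmetric complex Gaussian distribution `CN(0, v)` on `ℂ`: independent real and
imaginary parts, each of law `N(0, v / 2)`. -/
def complexGaussian (v : ℝ) : Measure ℂ :=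
  ((gaussianReal 0 (v / 2).toNNReal).prod (gaussianReal 0 (v / 2).toNNReal)).map
    (fun p : ℝ × ℝ => (⟨p.1, p.2⟩ : ℂ))

/-- The law of `(h₁, …, h_K)` with independent `h_k ~ CN(0, v_k I_M)`. -/
def rayleighLaw (M : ℕ) {K : ℕ} (v : Fin K → ℝ) : Measure (Fin K → Fin M → ℂ) :=
  Measure.pi fun k => Measure.pi fun _ => complexGaussian (v k)

/-- Rayleigh fading with random variances: conditionally on `(lam₁, …, lam_K)`, the columns of `H`
are independent and the `k`-th one has law `CN(0, lam_k I_M)`. -/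
def IsRayleighFading {M K : ℕ} {Ω : Type*} [MeasurableSpace Ω] (μ : Measure Ω)
    (lam : Fin K → Ω → ℝ) (H : Ω → Matrix (Fin M) (Fin K) ℂ) : Prop :=
  ∀ A : Set (Fin K → ℝ), MeasurableSet A → ∀ B : Set (Fin K → Fin M → ℂ), MeasurableSet B →
    μ {ω | (fun k => lam k ω) ∈ A ∧ (fun k m => H ω m k) ∈ B} =
      ∫⁻ ω in {ω | (fun k => lam k ω) ∈ A}, rayleighLaw M (fun k => lam k ω) B ∂μ

/-- `f` is a probability density on `(0, ∞)` of the real random variable `X`. -/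
def HasPosDensity {Ω : Type*} [MeasurableSpace Ω] (μ : Measure Ω) (X : Ω → ℝ) (f : ℝ → ℝ) : Prop :=
  μ.map X = (volume.restrict (Set.Ioi 0)).withDensity (fun x => ENNReal.ofReal (f x))

/-- `A_λ = ∫₀^∞ (σ² / x) f(x) dx` as a real number (meaningful when the integral converges). -/
def propConst (σ : ℝ) (f : ℝ → ℝ) : ℝ :=
  ∫ x in Set.Ioi (0 : ℝ), σ ^ 2 / x * f x

/-- `A_λ = ∫₀^∞ (σ² / x) f(x) dx` as an element of `[0, ∞]`. -/
def propConstENN (σ : ℝ) (f : ℝ → ℝ) : ENNReal :=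
  ∫⁻ x in Set.Ioi (0 : ℝ), ENNReal.ofReal (σ ^ 2 / x * f x)

end ZFPrecoding

end

noncomputable section

namespace ZFPrecoding

/-! For `V = H (Hᴴ H)⁻¹ D` one has `Hᴴ V = D`: interference vanishes and the SINR of user `k` is
`|d_k|² / σ²`. The rate determines the SINR, hence `|d_k|² = ρ σ² (M - K)`, and the power of user
`k` is `|d_k|²` times the `k`-th diagonal entry of `(Hᴴ H)⁻¹` (`power_of_rate`). Summing gives the
trace.

For the average, that diagonal entry is `1 / ‖P h_k‖²`, with `P` the projection onto the orthogonal
complement of the other columns (`inv_gram_apply_self_mul`). For standard Gaussian columns this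
complement almost surely has dimension `m = M - K + 1 ≥ 2` and is independent of `h_k`, so `P h_k`
is a standard Gaussian vector in dimension `m`. From `1 / x = ∫ exp (-t x) dt` and `E exp (-t ‖z‖²)
= (1 + t)⁻ᵐ` follows `E ‖z‖⁻² = 1 / (m - 1) = 1 / (M - K)`. Variances only rescale columns and
contribute a factor `1 / λ_k`; the factor `M - K` then cancels. Finiteness of the same expectation
also shows that `P h_k ≠ 0` almost surely, which yields almost sure invertibility by induction on
the number of columns. -/

/-! ### Complex Gaussian laws and their unitary invariance. -/

instance isProbabilityMeasure_complexGaussian (v : ℝ) : IsProbabilityMeasure (complexGaussian v) :=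
  Measure.isProbabilityMeasure_map
    (Complex.measurableEquivRealProd.symm.measurable.aemeasurable)

lemma measurable_complex_mk : Measurable (fun p : ℝ × ℝ => (⟨p.1, p.2⟩ : ℂ)) :=
  Complex.measurableEquivRealProd.symm.measurable

/-- A complex Gaussian variable of variance `v` is `√v` times a standard one. -/
lemma complexGaussian_eq_map (v : ℝ) :
    complexGaussian v = (complexGaussian 1).map (fun z => (Real.sqrt v : ℂ) * z) := by
  have hg : gaussianReal 0 (v / 2).toNNReal
      = (gaussianReal 0 (1 / 2 : ℝ).toNNReal).map (fun x => Real.sqrt v * x) := by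
    rw [gaussianReal_map_const_mul]
    congr 1
    · simp
    · ext
      -- For `v ≤ 0` the truncated variance and `√v` are both `0`, so no sign condition on `v` is
      -- needed.
      rcases le_total 0 v with h | h
      · simp [Real.sq_sqrt h, Real.coe_toNNReal _ (div_nonneg h zero_le_two)]
        ring
      · simp [Real.sqrt_eq_zero_of_nonpos h]
        linarith
  rw [complexGaussian, hg, Measure.map_prod_map _ _ (by fun_prop) (by fun_prop), complexGaussian,
    Measure.map_map measurable_complex_mk (by fun_prop),
    Measure.map_map (by fun_prop) measurable_complex_mk]
  congr 1
  ext p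
  apply Complex.ext <;> simp

lemma charFun_complexGaussian_one (t : ℂ) :
    charFun (complexGaussian 1) t = Complex.exp (-(‖t‖ ^ 2 : ℝ) / 4) := by
  rw [charFun_apply, complexGaussian, integral_map measurable_complex_mk.aemeasurable
    (by fun_prop)]
  have h : ∀ p : ℝ × ℝ, Complex.exp ((inner ℝ (⟨p.1, p.2⟩ : ℂ) t : ℝ) * Complex.I)
      = Complex.exp (t.re * p.1 * Complex.I) * Complex.exp (t.im * p.2 * Complex.I) := by
    intro p
    rw [← Complex.exp_add]
    congr 1
    simp [Complex.inner]
    ring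
  simp_rw [h]
  rw [integral_prod_mul (fun x : ℝ => Complex.exp (t.re * x * Complex.I))
    (fun x : ℝ => Complex.exp (t.im * x * Complex.I)),
    ← charFun_apply_real, ← charFun_apply_real, charFun_gaussianReal, charFun_gaussianReal,
    ← Complex.exp_add]
  congr 1
  rw [Complex.sq_norm, Complex.normSq_apply]
  push_cast
  simp
  ring

/-- The standard complex Gaussian distribution on `ℂᴹ`. -/
def stdComplexGaussian (M : ℕ) : Measure (EuclideanSpace ℂ (Fin M)) :=
  (Measure.pi fun _ : Fin M => complexGaussian 1).map (WithLp.toLp 2)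

instance isProbabilityMeasure_stdComplexGaussian (M : ℕ) :
    IsProbabilityMeasure (stdComplexGaussian M) :=
  Measure.isProbabilityMeasure_map (by fun_prop)

/-- Dependence on `t` through `‖t‖` alone is the source of unitary invariance. -/
lemma charFun_stdComplexGaussian {M : ℕ} (t : EuclideanSpace ℂ (Fin M)) :
    charFun (stdComplexGaussian M) t = Complex.exp (-(‖t‖ ^ 2 : ℝ) / 4) := by
  rw [stdComplexGaussian, charFun_pi]
  simp_rw [charFun_complexGaussian_one]
  rw [← Complex.exp_sum, EuclideanSpace.norm_sq_eq]
  push_cast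
  rw [← Finset.sum_div, Finset.sum_neg_distrib]

/-- The adjoint of an isometric embedding maps standard complex Gaussian vectors to
standard complex Gaussian vectors. -/
lemma map_adjoint_stdComplexGaussian {m M : ℕ}
    (L : EuclideanSpace ℂ (Fin m) →ₗᵢ[ℂ] EuclideanSpace ℂ (Fin M)) :
    (stdComplexGaussian M).map (ContinuousLinearMap.adjoint L.toContinuousLinearMap)
      = stdComplexGaussian m := by
  refine Measure.ext_of_charFun (E := EuclideanSpace ℂ (Fin m)) ?_
  ext t
  rw [charFun_apply, integral_map (by fun_prop) (by fun_prop)]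
  -- `charFun` uses the real inner product, the real part of the complex one for which the adjoint
  -- is taken.
  have h : ∀ x : EuclideanSpace ℂ (Fin M),
      inner ℝ (ContinuousLinearMap.adjoint L.toContinuousLinearMap x) t = inner ℝ x (L t) := by
    intro x
    have := ContinuousLinearMap.adjoint_inner_left L.toContinuousLinearMap t x
    have h2 := congrArg Complex.re this
    simpa [PiLp.inner_apply, Complex.inner] using h2
  simp_rw [h]
  rw [← charFun_apply, charFun_stdComplexGaussian, charFun_stdComplexGaussian, L.norm_map]

/-! ### Mean inverse squared norm, by Laplace transforms. -/

lemma integral_exp_neg_mul_sq_gaussianReal {t : ℝ} (ht : 0 < t) :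
    ∫ x, Real.exp (-t * x ^ 2) ∂(gaussianReal 0 (1 / 2 : ℝ).toNNReal) = (Real.sqrt (1 + t))⁻¹ := by
  rw [integral_gaussianReal_eq_integral_smul (by simp)]
  simp only [gaussianPDFReal, smul_eq_mul]
  have h : ∀ x : ℝ, (Real.sqrt (2 * Real.pi * ((1 / 2 : ℝ).toNNReal : ℝ)))⁻¹ *
      Real.exp (-(x - 0) ^ 2 / (2 * ((1 / 2 : ℝ).toNNReal : ℝ))) * Real.exp (-t * x ^ 2)
      = (Real.sqrt Real.pi)⁻¹ * Real.exp (-(1 + t) * x ^ 2) := by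
    intro x
    rw [Real.coe_toNNReal _ (by norm_num), mul_assoc, ← Real.exp_add]
    congr 2
    · congr 1; ring
    · ring
  simp_rw [h]
  rw [integral_const_mul, integral_gaussian, Real.sqrt_div Real.pi_pos.le]
  have := (Real.sqrt_pos.2 Real.pi_pos).ne'
  field_simp

lemma integral_exp_neg_mul_norm_sq_complexGaussian {t : ℝ} (ht : 0 < t) :
    ∫ z, Real.exp (-t * ‖z‖ ^ 2) ∂(complexGaussian 1) = (1 + t)⁻¹ := by
  rw [complexGaussian, integral_map measurable_complex_mk.aemeasurable (by fun_prop)]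
  have h : ∀ p : ℝ × ℝ, Real.exp (-t * ‖(⟨p.1, p.2⟩ : ℂ)‖ ^ 2)
      = Real.exp (-t * p.1 ^ 2) * Real.exp (-t * p.2 ^ 2) := by
    intro p
    rw [← Real.exp_add, Complex.sq_norm, Complex.normSq_apply]
    congr 1
    ring
  simp_rw [h]
  rw [integral_prod_mul (fun x : ℝ => Real.exp (-t * x ^ 2))
    (fun x : ℝ => Real.exp (-t * x ^ 2)), integral_exp_neg_mul_sq_gaussianReal ht,
    ← mul_inv, Real.mul_self_sqrt (by positivity)]

lemma integral_exp_neg_mul_norm_sq_stdComplexGaussian {t : ℝ} (ht : 0 < t) (m : ℕ) :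
    ∫ z, Real.exp (-t * ‖z‖ ^ 2) ∂(stdComplexGaussian m) = ((1 + t)⁻¹) ^ m := by
  rw [stdComplexGaussian, integral_map (by fun_prop) (by fun_prop)]
  simp_rw [EuclideanSpace.norm_sq_eq, Finset.mul_sum, Real.exp_sum]
  rw [integral_fintype_prod_eq_prod (fun _ : Fin m => fun z : ℂ => Real.exp (-t * ‖z‖ ^ 2))]
  simp_rw [integral_exp_neg_mul_norm_sq_complexGaussian ht]
  simp

/-- The antiderivative `-(1 + t)^(-(m - 1)) / (m - 1)` vanishes at infinity because `m ≥ 2`. -/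
lemma lintegral_Ioi_inv_one_add_pow {m : ℕ} (hm : 2 ≤ m) :
    ∫⁻ t in Set.Ioi (0 : ℝ), ENNReal.ofReal (((1 + t)⁻¹) ^ m)
      = ENNReal.ofReal (((m : ℝ) - 1)⁻¹) := by
  have hm' : (0 : ℝ) < (m : ℝ) - 1 := by
    have : (2 : ℝ) ≤ m := by exact_mod_cast hm
    linarith
  have hd : ∀ t ∈ Set.Ici (0 : ℝ), HasDerivAt
      (fun t : ℝ => -((m : ℝ) - 1)⁻¹ * ((1 + t)⁻¹) ^ (m - 1)) (((1 + t)⁻¹) ^ m) t := by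
    intro t ht
    have h1 : (1 + t) ≠ 0 := by have : 0 ≤ t := ht; positivity
    have h2 := (((((hasDerivAt_id t).const_add 1).inv h1).pow (m - 1)).const_mul
      (-((m : ℝ) - 1)⁻¹))
    refine h2.congr_deriv ?_
    obtain ⟨k, rfl⟩ : ∃ k, m = k + 2 := ⟨m - 2, by omega⟩
    have : (k : ℝ) + 2 - 1 ≠ 0 := by push_cast at hm'; exact hm'.ne'
    have h1' : 1 + id t ≠ 0 := h1
    push_cast [Nat.add_sub_cancel]
    simp
    have h3 : (k : ℝ) + 1 ≠ 0 := by positivity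
    rw [show (k : ℝ) + 2 - 1 = k + 1 by ring]
    field_simp
    ring
  have hlim : Filter.Tendsto (fun t : ℝ => -((m : ℝ) - 1)⁻¹ * ((1 + t)⁻¹) ^ (m - 1))
      Filter.atTop (nhds 0) := by
    have h1 : Filter.Tendsto (fun t : ℝ => (1 + t)⁻¹) Filter.atTop (nhds 0) :=
      tendsto_inv_atTop_zero.comp (Filter.tendsto_atTop_add_const_left _ _ Filter.tendsto_id)
    have := (h1.pow (m - 1)).const_mul (-((m : ℝ) - 1)⁻¹)
    simpa [zero_pow (show m - 1 ≠ 0 by omega)] using this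
  have hnn : ∀ t ∈ Set.Ioi (0 : ℝ), 0 ≤ ((1 + t)⁻¹) ^ m := by
    intro t ht; have : 0 < t := ht; positivity
  rw [← ofReal_integral_eq_lintegral_ofReal (integrableOn_Ioi_deriv_of_nonneg' hd hnn hlim)
    ((ae_restrict_iff' measurableSet_Ioi).2 (ae_of_all _ hnn)),
    integral_Ioi_of_hasDerivAt_of_nonneg' hd hnn hlim]
  simp

/-- At `x = 0` both sides are `∞`, so the formula can be used without knowing that a norm is
nonzero. -/
lemma lintegral_Ioi_exp_neg_mul {x : ℝ} (hx : 0 ≤ x) :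
    ∫⁻ t in Set.Ioi (0 : ℝ), ENNReal.ofReal (Real.exp (-t * x)) = (ENNReal.ofReal x)⁻¹ := by
  rcases hx.eq_or_lt with rfl | hx
  · simp
  · have hf : (fun t : ℝ => Real.exp (-t * x)) = fun t => Real.exp (-x * t) := by
      ext t; congr 1; ring
    simp_rw [congrFun hf]
    rw [← ofReal_integral_eq_lintegral_ofReal (exp_neg_integrableOn_Ioi 0 hx)
      (ae_of_all _ fun t => (Real.exp_pos _).le), integral_exp_mul_Ioi (by linarith),
      ← ENNReal.ofReal_inv_of_pos hx]
    simp

/-- The mean of `1 / ‖z‖²` for a standard complex Gaussian vector of dimension at least two. -/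
lemma lintegral_inv_norm_sq_stdComplexGaussian {m : ℕ} (hm : 2 ≤ m) :
    ∫⁻ z, (ENNReal.ofReal (‖z‖ ^ 2))⁻¹ ∂(stdComplexGaussian m)
      = ENNReal.ofReal (((m : ℝ) - 1)⁻¹) := by
  simp_rw [← lintegral_Ioi_exp_neg_mul (sq_nonneg ‖_‖)]
  rw [lintegral_lintegral_swap (by fun_prop), ← lintegral_Ioi_inv_one_add_pow hm]
  refine setLIntegral_congr_fun measurableSet_Ioi fun t (ht : 0 < t) => ?_
  beta_reduce
  rw [← integral_exp_neg_mul_norm_sq_stdComplexGaussian ht m, ofReal_integral_eq_lintegral_ofReal]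
  · refine Integrable.of_bound (by fun_prop) 1 (ae_of_all _ fun z => ?_)
    rw [Real.norm_of_nonneg (Real.exp_pos _).le, Real.exp_le_one_iff]
    nlinarith [sq_nonneg ‖z‖]
  · exact ae_of_all _ fun z => (Real.exp_pos _).le

/-- The mean of the inverse squared norm of the projection of a standard complex Gaussian vector
to a subspace of dimension at least two. -/
lemma lintegral_inv_norm_sq_starProjection {M : ℕ} (U : Submodule ℂ (EuclideanSpace ℂ (Fin M)))
    (hU : 2 ≤ Module.finrank ℂ U) :
    ∫⁻ h, (ENNReal.ofReal (‖U.starProjection (WithLp.toLp 2 h)‖ ^ 2))⁻¹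
        ∂(Measure.pi fun _ : Fin M => complexGaussian 1)
      = ENNReal.ofReal (((Module.finrank ℂ U : ℝ) - 1)⁻¹) := by
  let b := stdOrthonormalBasis ℂ U
  let L := U.subtypeₗᵢ.comp b.repr.symm.toLinearIsometry
  -- `L` identifies `ℂᵐ` isometrically with `U`, so its adjoint gives the coordinates of the
  -- projection in an orthonormal basis.
  have hL : ∀ h, ‖U.starProjection h‖
      = ‖ContinuousLinearMap.adjoint L.toContinuousLinearMap h‖ := by
    intro h
    have : ContinuousLinearMap.adjoint L.toContinuousLinearMap h
        = b.repr (U.orthogonalProjectionOnto h) := by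
      refine ext_inner_right ℂ fun y => ?_
      rw [ContinuousLinearMap.adjoint_inner_left, ← b.repr.symm.inner_map_map,
        LinearIsometryEquiv.symm_apply_apply]
      exact (Submodule.inner_orthogonalProjectionOnto_eq_of_mem_right _ _).symm
    rw [this, b.repr.norm_map, U.starProjection_apply]
    rfl
  rw [← lintegral_inv_norm_sq_stdComplexGaussian hU, ← map_adjoint_stdComplexGaussian L,
    lintegral_map (by fun_prop) (by fun_prop), stdComplexGaussian,
    lintegral_map (by fun_prop) (by fun_prop)]
  simp_rw [hL]

/-! ### Gram matrices and distances to spans. -/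

open scoped ComplexOrder in
lemma isUnit_gram_iff {M K : ℕ} (H : Matrix (Fin M) (Fin K) ℂ) :
    IsUnit (Hᴴ * H) ↔ LinearIndependent ℂ H.col := by
  rw [← Matrix.mulVec_injective_iff, ← Matrix.mulVec_injective_iff_isUnit]
  have h := Matrix.conjTranspose_mul_self_mulVec_eq_zero H
  rw [← Matrix.coe_mulVecLin, ← Matrix.coe_mulVecLin, ← LinearMap.ker_eq_bot,
    ← LinearMap.ker_eq_bot, LinearMap.ker_eq_bot', LinearMap.ker_eq_bot']
  simp only [Matrix.mulVecLin_apply, h]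

lemma le_of_isUnit_gram {M K : ℕ} {H : Matrix (Fin M) (Fin K) ℂ} (hH : IsUnit (Hᴴ * H)) :
    K ≤ M := by
  simpa using ((isUnit_gram_iff H).1 hH).fintype_card_le_finrank

/-- Passes between bare columns and the Euclidean space in which projections live. -/
lemma linearIndependent_toLp {M K : ℕ} {z : Fin K → Fin M → ℂ} :
    LinearIndependent ℂ (fun j => (WithLp.toLp 2 (z j) : EuclideanSpace ℂ (Fin M))) ↔
      LinearIndependent ℂ z :=
  LinearMap.linearIndependent_iff_of_injOn
    (WithLp.linearEquiv 2 ℂ (Fin M → ℂ)).symm.toLinearMap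
    (WithLp.linearEquiv 2 ℂ (Fin M → ℂ)).symm.injective.injOn (v := z)

/-- The span of finitely many vectors, in the Euclidean space `ℂᴹ`. -/
def euclideanSpan {M n : ℕ} (z : Fin n → Fin M → ℂ) : Submodule ℂ (EuclideanSpace ℂ (Fin M)) :=
  Submodule.span ℂ (Set.range fun j => WithLp.toLp 2 (z j))

lemma conjTranspose_mulVec_apply {M K : ℕ} (H : Matrix (Fin M) (Fin K) ℂ)
    (u : EuclideanSpace ℂ (Fin M)) (l : Fin K) :
    (Hᴴ *ᵥ u.ofLp) l = inner ℂ (WithLp.toLp 2 (H.col l)) u := by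
  simp [PiLp.inner_apply, Matrix.mulVec, dotProduct, mul_comm]

/-- The diagonal entries of the inverse Gram matrix are the inverse squared distances of the columns
to the span of the others. -/
lemma inv_gram_apply_self_mul {M n : ℕ} {H : Matrix (Fin M) (Fin (n + 1)) ℂ}
    (hH : IsUnit (Hᴴ * H)) (k : Fin (n + 1)) :
    (Hᴴ * H)⁻¹ k k *
      ((‖(euclideanSpan fun j => H.col (k.succAbove j))ᗮ.starProjection
        (WithLp.toLp 2 (H.col k))‖ ^ 2 : ℝ) : ℂ) = 1 := by
  set W := euclideanSpan fun j => H.col (k.succAbove j) with hW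
  set h : EuclideanSpace ℂ (Fin M) := WithLp.toLp 2 (H.col k) with hh
  set u := Wᗮ.starProjection h with hu
  have hdec : W.starProjection h + u = h := W.starProjection_add_starProjection_orthogonal h
  have huW : u ∈ Wᗮ := Submodule.starProjection_apply_mem _ _
  have hhW : W.starProjection h ∈ W := Submodule.starProjection_apply_mem _ _
  obtain ⟨c, hc⟩ := (Submodule.mem_span_range_iff_exists_fun ℂ).1 hhW
  -- The residual `u` is `h_k` minus its expansion in the other columns, so `u = H w` with `w` equal
  -- to `1` at `k` and `-c` elsewhere. Orthogonality then makes `Hᴴ u` the multiple `‖u‖² e_k`.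
  have hmul : H *ᵥ (k.insertNth 1 (-c) : Fin (n + 1) → ℂ) = u.ofLp := by
    have hu' : u = h - W.starProjection h := eq_sub_of_add_eq' hdec
    rw [hu', ← hc]
    ext m
    simp [Matrix.mulVec, dotProduct, Fin.sum_univ_succAbove _ k, hh, mul_comm, sub_eq_add_neg]
  have hgram : (Hᴴ * H) *ᵥ (k.insertNth 1 (-c) : Fin (n + 1) → ℂ)
      = Pi.single k ((‖u‖ ^ 2 : ℝ) : ℂ) := by
    rw [← Matrix.mulVec_mulVec, hmul]
    ext l
    rw [conjTranspose_mulVec_apply]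
    rcases Fin.eq_self_or_eq_succAbove k l with rfl | ⟨j, rfl⟩
    · rw [Pi.single_eq_same, ← hh, ← hdec, inner_add_left,
        Submodule.inner_right_of_mem_orthogonal hhW huW, zero_add, inner_self_eq_norm_sq_to_K]
      push_cast
      rfl
    · rw [Pi.single_eq_of_ne (Fin.succAbove_ne k j)]
      have hj : WithLp.toLp 2 (H.col (k.succAbove j)) ∈ W :=
        Submodule.subset_span (Set.mem_range_self j)
      exact Submodule.inner_right_of_mem_orthogonal hj huW
  -- Apply the inverse Gram matrix and read off coordinate `k`, where `w` is `1`.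
  have hinv := congrArg (fun v => ((Hᴴ * H)⁻¹ *ᵥ v) k) hgram
  simp only [Matrix.mulVec_mulVec, Matrix.nonsing_inv_mul _ ((Matrix.isUnit_iff_isUnit_det _).1 hH),
    Matrix.one_mulVec, Fin.insertNth_apply_same, Matrix.mulVec_single] at hinv
  rw [hinv]
  simp

/-! ### SINR, rate and power of zero-forcing precoders. -/

lemma gram_mul_zf {M K : ℕ} {H : Matrix (Fin M) (Fin K) ℂ} (hH : IsUnit (Hᴴ * H))
    (d : Fin K → ℂ) :
    Hᴴ * (H * (Hᴴ * H)⁻¹ * Matrix.diagonal d) = Matrix.diagonal d := by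
  rw [← Matrix.mul_assoc, ← Matrix.mul_assoc,
    Matrix.mul_nonsing_inv _ ((Matrix.isUnit_iff_isUnit_det _).1 hH), Matrix.one_mul]

lemma sinr_zf {M K : ℕ} {H : Matrix (Fin M) (Fin K) ℂ} (hH : IsUnit (Hᴴ * H))
    (σ : ℝ) (d : Fin K → ℂ) (k : Fin K) :
    sinr σ H (H * (Hᴴ * H)⁻¹ * Matrix.diagonal d) k = ‖d k‖ ^ 2 / σ ^ 2 := by
  rw [sinr, gram_mul_zf hH, Matrix.diagonal_apply_eq, Finset.sum_eq_zero, zero_add]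
  intro l hl
  rw [Matrix.diagonal_apply_ne _ (Finset.ne_of_mem_erase hl).symm]
  simp

lemma power_eq {M K : ℕ} (V : Matrix (Fin M) (Fin K) ℂ) (k : Fin K) :
    ((power V k : ℝ) : ℂ) = (Vᴴ * V) k k := by
  rw [power, EuclideanSpace.norm_sq_eq]
  push_cast
  simp [Matrix.mul_apply, Complex.conj_mul']

/-- Since `Hᴴ V = D` and the inverse Gram matrix is Hermitian, `Vᴴ V = D* (Hᴴ H)⁻¹ D`. -/
lemma power_zf {M K : ℕ} {H : Matrix (Fin M) (Fin K) ℂ} (hH : IsUnit (Hᴴ * H))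
    (d : Fin K → ℂ) (k : Fin K) :
    ((power (H * (Hᴴ * H)⁻¹ * Matrix.diagonal d) k : ℝ) : ℂ)
      = ((‖d k‖ ^ 2 : ℝ) : ℂ) * (Hᴴ * H)⁻¹ k k := by
  have hherm : ((Hᴴ * H)⁻¹)ᴴ = (Hᴴ * H)⁻¹ :=
    (Matrix.isHermitian_conjTranspose_mul_self H).inv
  have : (H * (Hᴴ * H)⁻¹ * Matrix.diagonal d)ᴴ * (H * (Hᴴ * H)⁻¹ * Matrix.diagonal d)
      = Matrix.diagonal (star d) * (Hᴴ * H)⁻¹ * Matrix.diagonal d := by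
    rw [Matrix.conjTranspose_mul, Matrix.conjTranspose_mul, hherm, Matrix.mul_assoc,
      Matrix.mul_assoc _ Hᴴ, gram_mul_zf hH, Matrix.diagonal_conjTranspose, Matrix.mul_assoc]
  rw [power_eq, this, Matrix.mul_diagonal, Matrix.diagonal_mul, Pi.star_apply]
  push_cast
  rw [← Complex.conj_mul']
  simp
  ring

lemma sinr_nonneg {M K : ℕ} (σ : ℝ) (H V : Matrix (Fin M) (Fin K) ℂ) (k : Fin K) :
    0 ≤ sinr σ H V k := by
  unfold sinr
  positivity

lemma overhead_pos {K T : ℕ} (hKT : K < T) : 0 < 1 - (K : ℝ) / T := by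
  have hT : (0 : ℝ) < T := by exact_mod_cast (Nat.zero_le K).trans_lt hKT
  rw [sub_pos, div_lt_one hT]
  exact_mod_cast hKT

/-- The prefactor is positive because `K < T`, and the logarithm is injective on positive reals. -/
lemma rate_eq_iff {M K T : ℕ} (hKT : K < T) {σ x : ℝ} (hx : 0 ≤ x)
    (H V : Matrix (Fin M) (Fin K) ℂ) (k : Fin K) :
    rate T σ H V k = (1 - (K : ℝ) / T) * Real.logb 2 (1 + x) ↔ sinr σ H V k = x := by
  have h0 := sinr_nonneg σ H V k
  rw [rate, mul_right_inj' (overhead_pos hKT).ne']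
  constructor
  · intro h
    have := Real.logb_injOn_pos (b := 2) (by norm_num)
      (show 0 < 1 + sinr σ H V k by positivity) (show 0 < 1 + x by positivity) h
    linarith
  · rintro rfl
    rfl

/-- The power of each user under zero-forcing precoding with prescribed rate. -/
lemma power_of_rate {M K T : ℕ} (hKT : K < T) {ρ σ : ℝ} (hρ : 0 < ρ) (hσ : 0 < σ)
    {H V : Matrix (Fin M) (Fin K) ℂ} (hH : IsUnit (Hᴴ * H)) (hV : IsZF H V) {k : Fin K}
    (hr : rate T σ H V k = (1 - (K : ℝ) / T) * Real.logb 2 (1 + ρ * ((M : ℝ) - K))) :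
    ((power V k : ℝ) : ℂ) = ((ρ * σ ^ 2 * ((M : ℝ) - K) : ℝ) : ℂ) * (Hᴴ * H)⁻¹ k k := by
  obtain ⟨d, rfl⟩ := hV
  have hMK : (0 : ℝ) ≤ (M : ℝ) - K := by
    rw [sub_nonneg]; exact_mod_cast le_of_isUnit_gram hH
  rw [rate_eq_iff hKT (by positivity), sinr_zf hH, div_eq_iff (by positivity)] at hr
  rw [power_zf hH, hr]
  congr 2
  ring

lemma zf_eq {M K : ℕ} (ρ σ : ℝ) (H : Matrix (Fin M) (Fin K) ℂ) :
    zf ρ σ H = H * (Hᴴ * H)⁻¹ *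
      Matrix.diagonal (fun _ : Fin K => ((Real.sqrt (ρ * σ ^ 2 * ((M : ℝ) - K)) : ℝ) : ℂ)) :=
  Matrix.smul_eq_mul_diagonal _ _

/-! ### Standard Gaussian matrices: independence of columns and the mean inverse Gram matrix. -/

/-- The matrix with the given columns. -/
def colMatrix {M K : ℕ} (z : Fin K → Fin M → ℂ) : Matrix (Fin M) (Fin K) ℂ :=
  Matrix.of fun m k => z k m

instance isProbabilityMeasure_rayleighLaw (M : ℕ) {K : ℕ} (v : Fin K → ℝ) :
    IsProbabilityMeasure (rayleighLaw M v) := by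
  unfold rayleighLaw
  infer_instance

lemma isUnit_gram_colMatrix_iff {M K : ℕ} (z : Fin K → Fin M → ℂ) :
    IsUnit ((colMatrix z)ᴴ * colMatrix z) ↔ LinearIndependent ℂ z :=
  isUnit_gram_iff _

lemma continuous_gram {M K : ℕ} :
    Continuous fun z : Fin K → Fin M → ℂ => (colMatrix z)ᴴ * colMatrix z := by
  have h : Continuous fun z : Fin K → Fin M → ℂ => colMatrix z :=
    continuous_matrix fun i j => by
      simp only [colMatrix, Matrix.of_apply]
      fun_prop
  exact h.matrix_conjTranspose.matrix_mul h

lemma measurableSet_linearIndependent (M K : ℕ) :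
    MeasurableSet {z : Fin K → Fin M → ℂ | LinearIndependent ℂ z} := by
  simp_rw [← isUnit_gram_colMatrix_iff, Matrix.isUnit_iff_isUnit_det, isUnit_iff_ne_zero]
  exact (isOpen_ne_fun continuous_gram.matrix_det continuous_const).measurableSet

/-- The inverse is the adjugate over the determinant; its default value `0` on singular matrices
makes this formula global. -/
lemma measurable_inv_gram_apply {M K : ℕ} (i j : Fin K) :
    Measurable fun z : Fin K → Fin M → ℂ => ((colMatrix z)ᴴ * colMatrix z)⁻¹ i j := by
  simp_rw [Matrix.inv_def, Matrix.smul_apply, Ring.inverse_eq_inv', smul_eq_mul]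
  exact continuous_gram.matrix_det.measurable.inv.mul
    (continuous_gram.matrix_adjugate.matrix_elem i j).measurable

lemma finrank_orthogonal_euclideanSpan {M n : ℕ} {z : Fin n → Fin M → ℂ}
    (hz : LinearIndependent ℂ z) :
    n + Module.finrank ℂ (euclideanSpan z)ᗮ = M := by
  have h := Submodule.finrank_add_finrank_orthogonal (euclideanSpan z)
  have h' : Module.finrank ℂ (euclideanSpan z) = n :=
    (finrank_span_eq_card (linearIndependent_toLp.2 hz)).trans (Fintype.card_fin n)
  rwa [h', finrank_euclideanSpace_fin] at h

/-- Fewer than `M` independent standard complex Gaussian vectors in `ℂᴹ` are almost surely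
linearly independent. -/
lemma ae_linearIndependent {M K : ℕ} (hK : K < M) :
    ∀ᵐ z ∂(rayleighLaw M fun _ : Fin K => 1), LinearIndependent ℂ z := by
  induction K with
  | zero => exact ae_of_all _ fun z => linearIndependent_empty_type
  | succ n ih =>
    have mp := measurePreserving_piFinSuccAbove
      (fun _ : Fin (n + 1) => Measure.pi fun _ : Fin M => complexGaussian 1) 0
    rw [rayleighLaw, ← mp.symm.map_eq, ae_map_iff mp.symm.measurable.aemeasurable
      (measurableSet_linearIndependent _ _)]
    have hmeas : MeasurableSet {p | LinearIndependent ℂ ((MeasurableEquiv.piFinSuccAbove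
        (fun _ : Fin (n + 1) => Fin M → ℂ) 0).symm p)} :=
      mp.symm.measurable (measurableSet_linearIndependent M (n + 1))
    -- Swapping the quantifiers freezes the other columns before the new one is drawn.
    rw [Measure.ae_prod_iff_ae_ae hmeas, Measure.ae_ae_comm hmeas]
    filter_upwards [ih (by omega)] with z hz
    have hfin := finrank_orthogonal_euclideanSpan hz
    set W := euclideanSpan z with hW
    -- As `n + 1 < M`, the complement has dimension at least `2`, so `1 / dist²` has finite mean. It
    -- is therefore almost surely finite, and the new column avoids `W`.
    have hint := lintegral_inv_norm_sq_starProjection Wᗮ (by omega)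
    filter_upwards [ae_lt_top (by fun_prop) (hint.trans_ne ENNReal.ofReal_ne_top)] with h hh
    have hnot : WithLp.toLp 2 h ∉ W := by
      intro hmem
      rw [(Submodule.starProjection_apply_eq_zero_iff _).2
        (Submodule.le_orthogonal_orthogonal W hmem)] at hh
      simp at hh
    have key := linearIndependent_finCons.2 ⟨linearIndependent_toLp.2 hz, hnot⟩
    rw [← linearIndependent_toLp]
    have hcons : (fun j => (WithLp.toLp 2 ((MeasurableEquiv.piFinSuccAbove
        (fun _ : Fin (n + 1) => Fin M → ℂ) 0).symm (h, z) j) : EuclideanSpace ℂ (Fin M)))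
        = Fin.cons (WithLp.toLp 2 h) fun j => WithLp.toLp 2 (z j) := by
      ext j : 1
      refine Fin.cases ?_ (fun i => ?_) j <;> rfl
    rw [hcons]
    exact key

/-- The mean of a diagonal entry of the inverse complex Wishart matrix. -/
lemma lintegral_inv_gram_apply_self {M K : ℕ} (hK : K < M) (k : Fin K) :
    ∫⁻ z, ENNReal.ofReal (((colMatrix z)ᴴ * colMatrix z)⁻¹ k k).re
        ∂(rayleighLaw M fun _ : Fin K => 1) = ENNReal.ofReal (((M : ℝ) - K)⁻¹) := by
  cases K with
  | zero => exact k.elim0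
  | succ n =>
    have mp := measurePreserving_piFinSuccAbove
      (fun _ : Fin (n + 1) => Measure.pi fun _ : Fin M => complexGaussian 1) k
    have hf : Measurable fun z : Fin (n + 1) → Fin M → ℂ =>
        ENNReal.ofReal (((colMatrix z)ᴴ * colMatrix z)⁻¹ k k).re :=
      (Complex.measurable_re.comp (measurable_inv_gram_apply k k)).ennreal_ofReal
    have hae := ae_linearIndependent hK
    rw [rayleighLaw, ← mp.symm.map_eq, ae_map_iff mp.symm.measurable.aemeasurable
      (measurableSet_linearIndependent _ _)] at hae
    have hmeas : MeasurableSet {p | LinearIndependent ℂ ((MeasurableEquiv.piFinSuccAbove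
        (fun _ : Fin (n + 1) => Fin M → ℂ) k).symm p)} :=
      mp.symm.measurable (measurableSet_linearIndependent M (n + 1))
    rw [Measure.ae_prod_iff_ae_ae hmeas, Measure.ae_ae_comm hmeas] at hae
    rw [rayleighLaw, ← mp.symm.lintegral_comp hf]
    -- Tonelli, with column `k` as the inner variable and the other columns fixed.
    refine (lintegral_prod_symm' _ (hf.comp mp.symm.measurable)).trans ?_
    have hrest := ae_linearIndependent (M := M) (K := n) (by omega)
    rw [lintegral_congr_ae (g := fun _ => ENNReal.ofReal (((M : ℝ) - ((n + 1 : ℕ) : ℝ))⁻¹))]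
    · simp
    filter_upwards [hrest, hae] with z hz hz'
    have hfin := finrank_orthogonal_euclideanSpan hz
    set W := euclideanSpan z with hW
    have hint := lintegral_inv_norm_sq_starProjection Wᗮ (by omega)
    -- Only `n = K - 1` columns are projected out, so the complement has dimension `M - K + 1`.
    have hval : (Module.finrank ℂ Wᗮ : ℝ) - 1 = (M : ℝ) - ((n + 1 : ℕ) : ℝ) := by
      have : (n : ℝ) + Module.finrank ℂ Wᗮ = M := by exact_mod_cast hfin
      push_cast
      linarith
    rw [← hval, ← hint]
    refine lintegral_congr_ae ?_
    filter_upwards [hz'] with h hh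
    have key := inv_gram_apply_self_mul ((isUnit_gram_colMatrix_iff _).2 hh) k
    have hspan : (euclideanSpan fun j => (colMatrix ((MeasurableEquiv.piFinSuccAbove
        (fun _ : Fin (n + 1) => Fin M → ℂ) k).symm (h, z))).col (k.succAbove j)) = W :=
      congrArg euclideanSpan (funext fun j =>
        Fin.insertNth_apply_succAbove (α := fun _ => Fin M → ℂ) k h z j)
    have hcol : (colMatrix ((MeasurableEquiv.piFinSuccAbove
        (fun _ : Fin (n + 1) => Fin M → ℂ) k).symm (h, z))).col k = h :=
      Fin.insertNth_apply_same (α := fun _ => Fin M → ℂ) k h z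
    rw [hspan, hcol] at key
    have hpos : 0 < ‖Wᗮ.starProjection (WithLp.toLp 2 h)‖ ^ 2 := by
      refine lt_of_le_of_ne (sq_nonneg _) fun h0 => ?_
      rw [← h0] at key
      simp at key
    simp only [Function.comp_apply]
    rw [eq_inv_of_mul_eq_one_left key, ← Complex.ofReal_inv, Complex.ofReal_re,
      ENNReal.ofReal_inv_of_pos hpos]

/-! ### Reduction of general variances to unit variance. -/

/-- Scaling the columns of a standard complex Gaussian matrix. -/
def scale {M K : ℕ} (v : Fin K → ℝ) (z : Fin K → Fin M → ℂ) : Fin K → Fin M → ℂ :=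
  fun k m => (Real.sqrt (v k) : ℂ) * z k m

lemma rayleighLaw_eq_map (M : ℕ) {K : ℕ} (v : Fin K → ℝ) :
    rayleighLaw M v = (rayleighLaw M fun _ : Fin K => 1).map (scale v) := by
  have h1 : ∀ k, (Measure.pi fun _ : Fin M => complexGaussian (v k)) =
      (Measure.pi fun _ : Fin M => complexGaussian 1).map
        (fun z m => (Real.sqrt (v k) : ℂ) * z m) := by
    intro k
    have hv := complexGaussian_eq_map (v k)
    have : IsProbabilityMeasure
      ((complexGaussian 1).map fun z => (Real.sqrt (v k) : ℂ) * z) := hv ▸ inferInstance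
    rw [Measure.pi_map_pi (f := fun _ z => (Real.sqrt (v k) : ℂ) * z)
      (fun _ => by fun_prop), ← hv]
  have : ∀ k, IsProbabilityMeasure ((Measure.pi fun _ : Fin M => complexGaussian 1).map
        (fun z m => (Real.sqrt (v k) : ℂ) * z m)) := fun k => h1 k ▸ inferInstance
  unfold rayleighLaw scale
  rw [Measure.pi_map_pi (f := fun k (z : Fin M → ℂ) m => (Real.sqrt (v k) : ℂ) * z m)
      (fun _ => Measurable.aemeasurable (by fun_prop))]
  simp_rw [h1]

lemma colMatrix_scale {M K : ℕ} (v : Fin K → ℝ) (z : Fin K → Fin M → ℂ) :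
    colMatrix (scale v z) = colMatrix z * Matrix.diagonal (fun k => (Real.sqrt (v k) : ℂ)) := by
  ext m k
  simp [colMatrix, scale, mul_comm]

lemma gram_colMatrix_scale {M K : ℕ} (v : Fin K → ℝ) (z : Fin K → Fin M → ℂ) :
    (colMatrix (scale v z))ᴴ * colMatrix (scale v z) =
      Matrix.diagonal (fun k => (Real.sqrt (v k) : ℂ)) * ((colMatrix z)ᴴ * colMatrix z) *
        Matrix.diagonal (fun k => (Real.sqrt (v k) : ℂ)) := by
  have : star (fun k => (Real.sqrt (v k) : ℂ)) = fun k => (Real.sqrt (v k) : ℂ) := by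
    ext k; simp
  rw [colMatrix_scale, Matrix.conjTranspose_mul, Matrix.diagonal_conjTranspose, this]
  simp only [Matrix.mul_assoc]

lemma isUnit_diagonal_sqrt {K : ℕ} {v : Fin K → ℝ} (hv : ∀ k, 0 < v k) :
    IsUnit (Matrix.diagonal (fun k => (Real.sqrt (v k) : ℂ))) := by
  rw [Matrix.isUnit_diagonal, Pi.isUnit_iff]
  intro k
  simpa using (Real.sqrt_pos.2 (hv k)).ne'

lemma isUnit_gram_scale {M K : ℕ} {v : Fin K → ℝ} (hv : ∀ k, 0 < v k)
    {z : Fin K → Fin M → ℂ} (hz : LinearIndependent ℂ z) :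
    IsUnit ((colMatrix (scale v z))ᴴ * colMatrix (scale v z)) := by
  rw [gram_colMatrix_scale]
  exact ((isUnit_diagonal_sqrt hv).mul ((isUnit_gram_colMatrix_iff z).2 hz)).mul
    (isUnit_diagonal_sqrt hv)

/-- With `S` the diagonal matrix of the `√(v k)`, the Gram matrix `G` becomes `S G S`, whose inverse
is `S⁻¹ G⁻¹ S⁻¹`. This persists for singular `G`, where both inverses are `0`. -/
lemma inv_gram_scale_apply_self {M K : ℕ} {v : Fin K → ℝ} (hv : ∀ k, 0 < v k)
    (z : Fin K → Fin M → ℂ) (k : Fin K) :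
    (((colMatrix (scale v z))ᴴ * colMatrix (scale v z))⁻¹ k k).re =
      (v k)⁻¹ * (((colMatrix z)ᴴ * colMatrix z)⁻¹ k k).re := by
  have hd : (Matrix.diagonal (fun k => (Real.sqrt (v k) : ℂ)))⁻¹
      = Matrix.diagonal (fun k => (((Real.sqrt (v k))⁻¹ : ℝ) : ℂ)) := by
    refine Matrix.inv_eq_left_inv ?_
    rw [Matrix.diagonal_mul_diagonal, ← Matrix.diagonal_one]
    congr 1
    ext k
    rw [← Complex.ofReal_mul, inv_mul_cancel₀ (Real.sqrt_pos.2 (hv k)).ne', Complex.ofReal_one]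
  rw [gram_colMatrix_scale, Matrix.mul_inv_rev, Matrix.mul_inv_rev, hd, Matrix.diagonal_mul,
    Matrix.mul_diagonal, Complex.re_ofReal_mul, Complex.re_mul_ofReal]
  nth_rewrite 3 [← Real.mul_self_sqrt (hv k).le]
  rw [mul_inv]
  ring

/-! ### Random variances and Rayleigh fading. -/

section Fading

variable {M K : ℕ} {Ω : Type*} [MeasurableSpace Ω] {μ : Measure Ω}

lemma measurable_scale {lam : Fin K → Ω → ℝ} (hlam : ∀ k, Measurable (lam k)) :
    Measurable fun p : Ω × (Fin K → Fin M → ℂ) => scale (fun k => lam k p.1) p.2 := by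
  refine measurable_pi_lambda _ fun k => measurable_pi_lambda _ fun m => ?_
  have := hlam k
  unfold scale
  fun_prop

/-- Under Rayleigh fading the channel matrix is distributed as a standard complex Gaussian matrix,
independent of the variances, whose columns are scaled by the square roots of the variances. -/
lemma IsRayleighFading.map_eq [SFinite μ] {lam : Fin K → Ω → ℝ} {H : Ω → Matrix (Fin M) (Fin K) ℂ}
    (h : IsRayleighFading μ lam H) (hlam : ∀ k, Measurable (lam k))
    (hH : ∀ m k, Measurable fun ω => H ω m k) :
    μ.map (fun ω k m => H ω m k) = (μ.prod (rayleighLaw M fun _ : Fin K => 1)).map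
      (fun p => scale (fun k => lam k p.1) p.2) := by
  ext B hB
  have hHm : Measurable fun ω k m => H ω m k :=
    measurable_pi_lambda _ fun k => measurable_pi_lambda _ fun m => hH m k
  have hs := measurable_scale (M := M) hlam
  -- Only the marginal law of the channel is needed: a mixture over the variances, computed by
  -- sections of the product measure.
  have h1 := h Set.univ MeasurableSet.univ B hB
  simp only [Set.mem_univ, true_and, Set.ofPred_true, Measure.restrict_univ] at h1
  rw [Measure.map_apply hHm hB, Measure.map_apply hs hB, Measure.prod_apply (hs hB)]
  refine h1.trans (lintegral_congr fun ω => ?_)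
  rw [rayleighLaw_eq_map]
  exact Measure.map_apply (hs.comp measurable_prodMk_left) hB

lemma HasPosDensity.ae_pos {X : Ω → ℝ} {f : ℝ → ℝ} (h : HasPosDensity μ X f)
    (hX : Measurable X) : ∀ᵐ ω ∂μ, 0 < X ω := by
  have h1 : ∀ᵐ x ∂(μ.map X), x ∈ Set.Ioi (0 : ℝ) := by
    rw [h]
    exact (withDensity_absolutelyContinuous _ _).ae_le (ae_restrict_mem measurableSet_Ioi)
  exact ae_of_ae_map hX.aemeasurable h1

lemma HasPosDensity.lintegral_div {X : Ω → ℝ} {f : ℝ → ℝ} (h : HasPosDensity μ X f)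
    (hX : Measurable X) (hf : Measurable f) (hf0 : ∀ x, 0 ≤ f x) (σ : ℝ) :
    ∫⁻ ω, ENNReal.ofReal (σ ^ 2 / X ω) ∂μ = propConstENN σ f := by
  have hg : Measurable fun x : ℝ => ENNReal.ofReal (σ ^ 2 / x) := by fun_prop
  rw [← lintegral_map hg hX, h, lintegral_withDensity_eq_lintegral_mul _ (by fun_prop) hg]
  refine lintegral_congr fun x => ?_
  rw [Pi.mul_apply, ← ENNReal.ofReal_mul (hf0 x), mul_comm]

variable [SFinite μ] {lam : Fin K → Ω → ℝ} {H : Ω → Matrix (Fin M) (Fin K) ℂ}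

/-- Positive column scalings preserve invertibility of the Gram matrix, so the standard Gaussian
case transfers by Fubini. -/
lemma IsRayleighFading.ae_isUnit (h : IsRayleighFading μ lam H)
    (hlam : ∀ k, Measurable (lam k)) (hH : ∀ m k, Measurable fun ω => H ω m k)
    (hpos : ∀ᵐ ω ∂μ, ∀ k, 0 < lam k ω) (hKM : K < M) :
    ∀ᵐ ω ∂μ, IsUnit ((H ω)ᴴ * H ω) := by
  have hHm : Measurable fun ω k m => H ω m k :=
    measurable_pi_lambda _ fun k => measurable_pi_lambda _ fun m => hH m k
  have hs := measurable_scale (M := M) hlam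
  have hset : MeasurableSet
      {z : Fin K → Fin M → ℂ | IsUnit ((colMatrix z)ᴴ * colMatrix z)} := by
    simp_rw [isUnit_gram_colMatrix_iff]
    exact measurableSet_linearIndependent M K
  have key : ∀ᵐ z ∂(μ.map (fun ω k m => H ω m k)),
      IsUnit ((colMatrix z)ᴴ * colMatrix z) := by
    rw [h.map_eq hlam hH, ae_map_iff hs.aemeasurable hset]
    refine (Measure.ae_prod_iff_ae_ae (hs hset)).2 ?_
    filter_upwards [hpos] with ω hω
    filter_upwards [ae_linearIndependent hKM] with z hz
    exact isUnit_gram_scale hω hz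
  exact ae_of_ae_map hHm.aemeasurable key

lemma IsRayleighFading.lintegral_inv_gram (h : IsRayleighFading μ lam H)
    (hlam : ∀ k, Measurable (lam k)) (hH : ∀ m k, Measurable fun ω => H ω m k)
    (hpos : ∀ᵐ ω ∂μ, ∀ k, 0 < lam k ω) (hKM : K < M) (k : Fin K) :
    ∫⁻ ω, ENNReal.ofReal (((H ω)ᴴ * H ω)⁻¹ k k).re ∂μ
      = (∫⁻ ω, ENNReal.ofReal (lam k ω)⁻¹ ∂μ) * ENNReal.ofReal (((M : ℝ) - K)⁻¹) := by
  have hHm : Measurable fun ω k m => H ω m k :=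
    measurable_pi_lambda _ fun k => measurable_pi_lambda _ fun m => hH m k
  have hs := measurable_scale (M := M) hlam
  have hF : Measurable fun z : Fin K → Fin M → ℂ =>
      ENNReal.ofReal (((colMatrix z)ᴴ * colMatrix z)⁻¹ k k).re :=
    (Complex.measurable_re.comp (measurable_inv_gram_apply k k)).ennreal_ofReal
  have hlk := hlam k
  calc ∫⁻ ω, ENNReal.ofReal (((H ω)ᴴ * H ω)⁻¹ k k).re ∂μ
      = ∫⁻ z, ENNReal.ofReal (((colMatrix z)ᴴ * colMatrix z)⁻¹ k k).re
          ∂(μ.map (fun ω k m => H ω m k)) := (lintegral_map hF hHm).symm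
    _ = ∫⁻ ω, ENNReal.ofReal (lam k ω)⁻¹ * ENNReal.ofReal (((M : ℝ) - K)⁻¹) ∂μ := by
      rw [h.map_eq hlam hH, lintegral_map hF hs]
      refine (lintegral_prod _ (hF.comp hs).aemeasurable).trans (lintegral_congr_ae ?_)
      filter_upwards [hpos] with ω hω
      -- For fixed variances the factor `1 / λ_k` comes out, leaving the standard mean `1 / (M -
      -- K)`.
      simp_rw [Function.comp_apply, inv_gram_scale_apply_self hω, ENNReal.ofReal_mul (inv_pos.2 (hω k)).le]
      rw [lintegral_const_mul _ hF, lintegral_inv_gram_apply_self hKM]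
    _ = _ := lintegral_mul_const _ (by fun_prop)

/-- The mean power of user `k` under zero-forcing precoding with prescribed rate. -/
lemma IsRayleighFading.lintegral_power (h : IsRayleighFading μ lam H)
    (hlam : ∀ k, Measurable (lam k)) (hH : ∀ m k, Measurable fun ω => H ω m k)
    (hpos : ∀ᵐ ω ∂μ, ∀ k, 0 < lam k ω) (hKM : K < M) {ρ σ : ℝ} (hρ : 0 < ρ)
    {V : Ω → Matrix (Fin M) (Fin K) ℂ} {k : Fin K}
    (hV : ∀ᵐ ω ∂μ, power (V ω) k
      = ρ * σ ^ 2 * ((M : ℝ) - K) * (((H ω)ᴴ * H ω)⁻¹ k k).re) :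
    ∫⁻ ω, ENNReal.ofReal (power (V ω) k) ∂μ
      = ENNReal.ofReal ρ * ∫⁻ ω, ENNReal.ofReal (σ ^ 2 / lam k ω) ∂μ := by
  have hMK : (0 : ℝ) < (M : ℝ) - K := by rw [sub_pos]; exact_mod_cast hKM
  have hHm : Measurable fun ω k m => H ω m k :=
    measurable_pi_lambda _ fun k => measurable_pi_lambda _ fun m => hH m k
  have hF : Measurable fun ω => ENNReal.ofReal (((H ω)ᴴ * H ω)⁻¹ k k).re :=
    ((Complex.measurable_re.comp (measurable_inv_gram_apply k k)).ennreal_ofReal).comp hHm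
  have hlk := hlam k
  rw [lintegral_congr_ae (g := fun ω => ENNReal.ofReal (ρ * σ ^ 2 * ((M : ℝ) - K)) *
      ENNReal.ofReal (((H ω)ᴴ * H ω)⁻¹ k k).re) (by
        filter_upwards [hV] with ω hω
        rw [hω, ENNReal.ofReal_mul (by positivity)]),
    lintegral_const_mul _ hF, h.lintegral_inv_gram hlam hH hpos hKM]
  simp_rw [div_eq_mul_inv, ENNReal.ofReal_mul (sq_nonneg σ)]
  rw [lintegral_const_mul _ (by fun_prop), mul_comm (∫⁻ ω, _ ∂μ), ← mul_assoc, ← mul_assoc,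
    ← ENNReal.ofReal_mul (by positivity), ← ENNReal.ofReal_mul (by positivity)]
  -- The SNR factor `M - K` cancels the mean `1 / (M - K)`.
  congr 2
  field_simp

end Fading

end ZFPrecoding

end

/-! ### Assembly of the fixed-channel and averaged statements. -/

theorem lemma1 (M K T : ℕ) (hKT : K < T) (ρ σ : ℝ) (hρ : 0 < ρ) (hσ : 0 < σ) :
    -- a fixed channel realization
    (∀ H : Matrix (Fin M) (Fin K) ℂ, IsUnit (Hᴴ * H) →
      (∀ V : Matrix (Fin M) (Fin K) ℂ, ZFPrecoding.IsZF H V →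
        (∀ k, ZFPrecoding.rate T σ H V k =
          (1 - (K : ℝ) / T) * Real.logb 2 (1 + ρ * ((M : ℝ) - K))) →
        ((∑ k, ZFPrecoding.power V k : ℝ) : ℂ) =
          ((ρ * σ ^ 2 * ((M : ℝ) - K) : ℝ) : ℂ) * ((Hᴴ * H)⁻¹).trace) ∧
      ZFPrecoding.IsZF H (ZFPrecoding.zf ρ σ H) ∧
      (∀ k, (Hᴴ * ZFPrecoding.zf ρ σ H) k k =
        ((Real.sqrt (ρ * σ ^ 2 * ((M : ℝ) - K)) : ℝ) : ℂ)) ∧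
      (∀ k, ZFPrecoding.rate T σ H (ZFPrecoding.zf ρ σ H) k =
        (1 - (K : ℝ) / T) * Real.logb 2 (1 + ρ * ((M : ℝ) - K)))) ∧
    -- the average over Rayleigh fading with random variances
    (K < M →
      ∀ (Ω : Type*) [MeasurableSpace Ω] (μ : MeasureTheory.Measure Ω)
        [MeasureTheory.IsProbabilityMeasure μ]
        (f : ℝ → ℝ) (lam : Fin K → Ω → ℝ) (H V : Ω → Matrix (Fin M) (Fin K) ℂ),
        Measurable f → (∀ x, 0 ≤ f x) →
        (∀ k, Measurable (lam k)) → (∀ m k, Measurable fun ω => H ω m k) →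
        ProbabilityTheory.iIndepFun lam μ →
        (∀ k, ZFPrecoding.HasPosDensity μ (lam k) f) →
        ZFPrecoding.IsRayleighFading μ lam H →
        (∀ᵐ ω ∂μ, IsUnit ((H ω)ᴴ * H ω) → ZFPrecoding.IsZF (H ω) (V ω) ∧
          ∀ k, ZFPrecoding.rate T σ (H ω) (V ω) k =
            (1 - (K : ℝ) / T) * Real.logb 2 (1 + ρ * ((M : ℝ) - K))) →
        (∀ᵐ ω ∂μ, IsUnit ((H ω)ᴴ * H ω)) ∧
        (∀ k, ZFPrecoding.avgRate μ T σ H V k =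
          (1 - (K : ℝ) / T) * Real.logb 2 (1 + ρ * ((M : ℝ) - K))) ∧
        -- the average power as an identity in `[0, ∞]`
        (∀ k, ∫⁻ ω, ENNReal.ofReal (σ ^ 2 / lam k ω) ∂μ = ZFPrecoding.propConstENN σ f) ∧
        ∑ k, ∫⁻ ω, ENNReal.ofReal (ZFPrecoding.power (V ω) k) ∂μ =
          ENNReal.ofReal (ρ * K) * ZFPrecoding.propConstENN σ f ∧
        -- the average power as an identity of real numbers
        (MeasureTheory.IntegrableOn (fun x => σ ^ 2 / x * f x) (Set.Ioi 0) →
          (∀ k, MeasureTheory.Integrable (fun ω => σ ^ 2 / lam k ω) μ ∧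
            ∫ ω, σ ^ 2 / lam k ω ∂μ = ZFPrecoding.propConst σ f) ∧
          (∀ k, MeasureTheory.Integrable (fun ω => ZFPrecoding.power (V ω) k) μ) ∧
          ∑ k, ∫ ω, ZFPrecoding.power (V ω) k ∂μ = ρ * K * ZFPrecoding.propConst σ f)) := by
  refine ⟨fun H hH => ?_, fun hKM Ω _ μ _ f lam H V hf hf0 hlam hHm _ hdens hfad hV => ?_⟩
  · have hMK : (0 : ℝ) ≤ (M : ℝ) - K := by
      rw [sub_nonneg]; exact_mod_cast ZFPrecoding.le_of_isUnit_gram hH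
    refine ⟨fun V hV hr => ?_, ⟨_, ZFPrecoding.zf_eq ρ σ H⟩, fun k => ?_, fun k => ?_⟩
    · rw [Complex.ofReal_sum, Matrix.trace, Finset.mul_sum]
      exact Finset.sum_congr rfl fun k _ =>
        ZFPrecoding.power_of_rate hKT hρ hσ hH hV (hr k)
    · rw [ZFPrecoding.zf_eq, ZFPrecoding.gram_mul_zf hH, Matrix.diagonal_apply_eq]
    · rw [ZFPrecoding.rate_eq_iff hKT (by positivity), ZFPrecoding.zf_eq,
        ZFPrecoding.sinr_zf hH, Complex.norm_real, Real.norm_eq_abs, sq_abs,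
        Real.sq_sqrt (by positivity)]
      field_simp
  have hMK : (0 : ℝ) < (M : ℝ) - K := by rw [sub_pos]; exact_mod_cast hKM
  have hpos : ∀ᵐ ω ∂μ, ∀ k, 0 < lam k ω :=
    ae_all_iff.2 fun k => (hdens k).ae_pos (hlam k)
  have hunit := hfad.ae_isUnit hlam hHm hpos hKM
  have hVZ : ∀ᵐ ω ∂μ, ZFPrecoding.IsZF (H ω) (V ω) ∧
      ∀ k, ZFPrecoding.rate T σ (H ω) (V ω) k =
        (1 - (K : ℝ) / T) * Real.logb 2 (1 + ρ * ((M : ℝ) - K)) := by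
    filter_upwards [hunit, hV] with ω h1 h2 using h2 h1
  have hpow : ∀ k, ∀ᵐ ω ∂μ, ZFPrecoding.power (V ω) k
      = ρ * σ ^ 2 * ((M : ℝ) - K) * (((H ω)ᴴ * H ω)⁻¹ k k).re := by
    intro k
    filter_upwards [hunit, hVZ] with ω h1 h2
    have := congrArg Complex.re (ZFPrecoding.power_of_rate hKT hρ hσ h1 h2.1 (h2.2 k))
    rwa [Complex.ofReal_re, Complex.re_ofReal_mul] at this
  have hA : ∀ k, ∫⁻ ω, ENNReal.ofReal (σ ^ 2 / lam k ω) ∂μ = ZFPrecoding.propConstENN σ f :=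
    fun k => (hdens k).lintegral_div (hlam k) hf hf0 σ
  have hP : ∀ k, ∫⁻ ω, ENNReal.ofReal (ZFPrecoding.power (V ω) k) ∂μ
      = ENNReal.ofReal ρ * ZFPrecoding.propConstENN σ f := fun k => by
    rw [hfad.lintegral_power hlam hHm hpos hKM hρ (hpow k), hA k]
  refine ⟨hunit, fun k => ?_, hA, ?_, fun hint => ?_⟩
  · rw [ZFPrecoding.avgRate, integral_congr_ae
      (g := fun _ => Real.logb 2 (1 + ρ * ((M : ℝ) - K)))]
    · simp
    · filter_upwards [hVZ] with ω h
      rw [(ZFPrecoding.rate_eq_iff hKT (by positivity) _ _ k).1 (h.2 k)]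
  · simp_rw [hP]
    rw [Finset.sum_const, Finset.card_univ, Fintype.card_fin, nsmul_eq_mul, ← mul_assoc,
      mul_comm ρ, ENNReal.ofReal_mul (Nat.cast_nonneg K), ENNReal.ofReal_natCast]
  have hnn : ∀ᵐ x ∂(volume.restrict (Set.Ioi (0 : ℝ))), 0 ≤ σ ^ 2 / x * f x := by
    filter_upwards [ae_restrict_mem measurableSet_Ioi] with x (hx : 0 < x)
    have := hf0 x
    positivity
  -- Integrability lets the `[0, ∞]` identities descend to real ones.
  have hC : ZFPrecoding.propConstENN σ f = ENNReal.ofReal (ZFPrecoding.propConst σ f) :=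
    (ofReal_integral_eq_lintegral_ofReal hint hnn).symm
  have hC0 : 0 ≤ ZFPrecoding.propConst σ f := integral_nonneg_of_ae hnn
  have hHcol : Measurable fun ω k m => H ω m k :=
    measurable_pi_lambda _ fun k => measurable_pi_lambda _ fun m => hHm m k
  -- `V` itself need not be measurable: its powers agree almost everywhere with measurable functions
  -- of `H`.
  have hPm : ∀ k, AEStronglyMeasurable (fun ω => ZFPrecoding.power (V ω) k) μ := by
    intro k
    have : Measurable fun ω => ρ * σ ^ 2 * ((M : ℝ) - K) * (((H ω)ᴴ * H ω)⁻¹ k k).re :=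
      ((Complex.measurable_re.comp
        (ZFPrecoding.measurable_inv_gram_apply k k)).comp hHcol).const_mul _
    exact this.aestronglyMeasurable.congr (Filter.EventuallyEq.symm (hpow k))
  have hP0 : ∀ k, ∀ᵐ ω ∂μ, 0 ≤ ZFPrecoding.power (V ω) k :=
    fun k => ae_of_all _ fun ω => sq_nonneg _
  have hlm : ∀ k, AEStronglyMeasurable (fun ω => σ ^ 2 / lam k ω) μ := by
    intro k
    have := hlam k
    exact Measurable.aestronglyMeasurable (by fun_prop)
  have hl0 : ∀ k, ∀ᵐ ω ∂μ, 0 ≤ σ ^ 2 / lam k ω := by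
    intro k
    filter_upwards [hpos] with ω hω
    exact div_nonneg (sq_nonneg _) (hω k).le
  refine ⟨fun k => ⟨⟨hlm k, ?_⟩, ?_⟩, fun k => ⟨hPm k, ?_⟩, ?_⟩
  · rw [hasFiniteIntegral_iff_ofReal (hl0 k), hA k, hC]
    exact ENNReal.ofReal_lt_top
  · rw [integral_eq_lintegral_of_nonneg_ae (hl0 k) (hlm k), hA k, hC, ENNReal.toReal_ofReal hC0]
  · rw [hasFiniteIntegral_iff_ofReal (hP0 k), hP k, hC, ← ENNReal.ofReal_mul hρ.le]
    exact ENNReal.ofReal_lt_top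
  · have : ∀ k, ∫ ω, ZFPrecoding.power (V ω) k ∂μ = ρ * ZFPrecoding.propConst σ f := by
      intro k
      rw [integral_eq_lintegral_of_nonneg_ae (hP0 k) (hPm k), hP k, hC, ← ENNReal.ofReal_mul hρ.le,
        ENNReal.toReal_ofReal (mul_nonneg hρ.le hC0)]
    simp_rw [this]
    rw [Finset.sum_const, Finset.card_univ, Fintype.card_fin, nsmul_eq_mul]
    ring
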